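/- Let $A$ be a $C^*$-algebra (not necessarily unital), faithfully and non-degenerately represented on a Hilbert space $H$, with multiplier algebra $M(A)$ (acting on $H$ by the canonical extension of the representation) and algebra of left multipliers $LM(A)$, that is, bounded operators $u:A\to A$ with $u(ab)=u(a)b$; $M(A)\subseteq LM(A)$. A sequence $u_n\in LM(A)$ converges left strictly to $u\in LM(A)$ if $\|u_n a-u a\|\to 0$ for every $a\in A$. Let $\ell_2(A)$ be the standard (right) Hilbert $A$-module of sequences $x=(x_i)$ in $A$ with $\sum_i x_i^*x_i$ norm-convergent and $\langle x,y\rangle=\sum_i x_i^*y_i$. Let $M(\ell_2(A))$ be its multiplier module: the adjointable maps $\beta:A\to\ell_2(A)$, with the right $M(A)$-action $(\beta m)(a)=\beta(ma)$, the $M(A)$-valued inner product $\langle\beta,\gamma\rangle=\beta^*\gamma$ and the norm $\|\beta\|=\|\langle\beta,\beta\rangle\|^{1/2}$; the coordinates $\beta_i\in M(A)$ of $\beta$ are given by $\beta_i a=(\beta(a))_i$. Let $(M(\ell_2(A)))'$ be the dual module of all bounded $M(A)$-linear maps $F:M(\ell_2(A))\to M(A)$, with the right $M(A)$-action $(Fm)(\beta)=m^*F(\beta)$.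 For a sequence $\alpha=(\alpha_i)$ in $M(A)$, the partial sums of $\sum_i\alpha_i^*\alpha_i$ are bounded in norm if and only if this series converges strongly in $B(H)$. The sequences $\alpha$ such that 1) the partial sums of $\sum_i\alpha_i^*\alpha_i$ are bounded (equivalently, the series converges strongly in $B(H)$); 2) the series $\sum_i\alpha_i^*\beta_i$ converges left strictly in $LM(A)$ for every $\beta\in M(\ell_2(A))$; 3) for every $\beta\in M(\ell_2(A))$ the limit in 2) belongs to $M(A)\subseteq LM(A)$; form a right $M(A)$-module under entrywise addition and $(\alpha m)_i=\alpha_i m$, and the dual module $(M(\ell_2(A)))'$ is isomorphic to it as a right $M(A)$-module, by an isomorphism under which the functional $F$ corresponding to $\alpha$ is $$F(\beta)=\sum_i\alpha_i^*\beta_i\qquad(\beta\in M(\ell_2(A))),$$ the series converging left strictly. -/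

import Mathlib

open Filter Topology
open scoped MultiplierAlgebra WithCStarModule

namespace MultiplierDual

noncomputable section

/-! ### The standard module `ℓ₂(A)` -/

section CauchySchwarz

variable {B : Type*} [NonUnitalCStarAlgebra B]

theorem norm_sum_star_mul_sq_le {ι : Type*} (s : Finset ι) (x y : ι → B) :
    ‖∑ i ∈ s, star (x i) * y i‖ ^ 2 ≤
      ‖∑ i ∈ s, star (x i) * x i‖ * ‖∑ i ∈ s, star (y i) * y i‖ := by
  let _ : PartialOrder B := CStarAlgebra.spectralOrder B
  have : StarOrderedRing B := CStarAlgebra.spectralOrderedRing B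
  let X : C⋆ᵐᵒᵈ(B, s → B) := (WithCStarModule.equiv B (s → B)).symm fun i => star (x i)
  let Y : C⋆ᵐᵒᵈ(B, s → B) := (WithCStarModule.equiv B (s → B)).symm fun i => star (y i)
  have h : ‖inner B Y X‖ ≤ ‖Y‖ * ‖X‖ := CStarModule.norm_inner_le (A := B) C⋆ᵐᵒᵈ(B, s → B)
  have h1 : inner B Y X = ∑ i ∈ s, star (x i) * y i := by
    rw [WithCStarModule.pi_inner, ← Finset.sum_coe_sort s]
    refine Finset.sum_congr rfl fun i _ => ?_
    rw [WithCStarModule.inner_def]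
    simp [X, Y]
  have h2 : ‖X‖ ^ 2 = ‖∑ i ∈ s, star (x i) * x i‖ := by
    rw [WithCStarModule.pi_norm_sq, ← Finset.sum_coe_sort s]
    congr 1
    refine Finset.sum_congr rfl fun i _ => ?_
    rw [WithCStarModule.inner_def]
    simp [X]
  have h3 : ‖Y‖ ^ 2 = ‖∑ i ∈ s, star (y i) * y i‖ := by
    rw [WithCStarModule.pi_norm_sq, ← Finset.sum_coe_sort s]
    congr 1
    refine Finset.sum_congr rfl fun i _ => ?_
    rw [WithCStarModule.inner_def]
    simp [Y]
  rw [← h1, ← h2, ← h3, ← mul_pow, mul_comm ‖X‖]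
  exact pow_le_pow_left₀ (norm_nonneg _) h 2

theorem norm_sum_star_add_le {ι : Type*} (s : Finset ι) (x y : ι → B) :
    ‖∑ i ∈ s, star (x i + y i) * (x i + y i)‖ ≤
      2 * (‖∑ i ∈ s, star (x i) * x i‖ + ‖∑ i ∈ s, star (y i) * y i‖) := by
  have e : ∑ i ∈ s, star (x i + y i) * (x i + y i) =
      (∑ i ∈ s, star (x i) * x i + ∑ i ∈ s, star (y i) * y i) +
      (∑ i ∈ s, star (x i) * y i + ∑ i ∈ s, star (y i) * x i) := by
    simp only [← Finset.sum_add_distrib]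
    refine Finset.sum_congr rfl fun i _ => ?_
    simp only [star_add, add_mul, mul_add]
    abel
  have h1 := norm_sum_star_mul_sq_le s x y
  have h2 := norm_sum_star_mul_sq_le s y x
  set a := ‖∑ i ∈ s, star (x i) * x i‖
  set b := ‖∑ i ∈ s, star (y i) * y i‖
  have ha : 0 ≤ a := norm_nonneg _
  have hb : 0 ≤ b := norm_nonneg _
  have key : ∀ t : ℝ, t ^ 2 ≤ a * b → t ≤ (a + b) / 2 := fun t ht => by
    nlinarith [sq_nonneg (a - b), abs_le_of_sq_le_sq' (a := t) (b := (a + b) / 2)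
      (by nlinarith [sq_nonneg (a - b)]) (by positivity)]
  have k1 := key _ h1
  have k2 := key _ (by rw [mul_comm a b]; exact h2)
  rw [e]
  refine (norm_add_le _ _).trans ?_
  refine (add_le_add (norm_add_le _ _) (norm_add_le _ _)).trans ?_
  linarith

theorem summable_star_mul {x y : ℕ → B} (hx : Summable fun i => star (x i) * x i)
    (hy : Summable fun i => star (y i) * y i) : Summable fun i => star (x i) * y i := by
  rw [summable_iff_vanishing_norm] at hx hy ⊢
  intro ε hε
  obtain ⟨s, hs⟩ := hx ε hε
  obtain ⟨t, ht⟩ := hy ε hε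
  classical
  refine ⟨s ∪ t, fun u hu => ?_⟩
  have h1 := hs u (hu.mono_right Finset.subset_union_left)
  have h2 := ht u (hu.mono_right Finset.subset_union_right)
  have h3 := norm_sum_star_mul_sq_le u x y
  have h4 : ‖∑ i ∈ u, star (x i) * y i‖ ^ 2 < ε ^ 2 := by
    refine h3.trans_lt ?_
    rw [sq]
    exact mul_lt_mul'' h1 h2 (norm_nonneg _) (norm_nonneg _)
  exact lt_of_pow_lt_pow_left₀ 2 hε.le h4

end CauchySchwarz

variable (A : Type*) [NonUnitalCStarAlgebra A]

/-- The standard Hilbert `A`-module `ℓ₂(A)`: the sequences `x` in `A` for which `∑ xᵢ* xᵢ`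
converges in norm. -/
def EllTwo : Submodule ℂ (ℕ → A) where
  carrier := {x | Summable fun i => star (x i) * x i}
  zero_mem' := by simpa using (summable_zero : Summable fun _ : ℕ => (0 : A))
  add_mem' {x y} hx hy := by
    have h := ((hx.add hy).add (summable_star_mul hx hy)).add (summable_star_mul hy hx)
    refine h.congr fun i => ?_
    simp only [Pi.add_apply, star_add, add_mul, mul_add]
    abel
  smul_mem' c x hx := by
    have h := Summable.const_smul (star c * c) hx
    refine h.congr fun i => ?_
    simp [smul_mul_smul_comm, star_smul]

variable {A}

/-- The `A`-valued inner product `⟨x, y⟩ = ∑ xᵢ* yᵢ` on `ℓ₂(A)`. -/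
def ellInner (x y : EllTwo A) : A := ∑' i, star (x.1 i) * y.1 i

theorem hasSum_ellInner (x y : EllTwo A) :
    HasSum (fun i => star (x.1 i) * y.1 i) (ellInner x y) :=
  (summable_star_mul x.2 y.2).hasSum

/-- The Hilbert module norm `‖x‖ = ‖⟨x, x⟩‖ ^ (1/2)` of `ℓ₂(A)`. -/
instance : Norm (EllTwo A) := ⟨fun x => √‖ellInner x x‖⟩

theorem ellNorm_sq (x : EllTwo A) : ‖x‖ ^ 2 = ‖ellInner x x‖ :=
  Real.sq_sqrt (norm_nonneg _)

theorem ellNorm_nonneg (x : EllTwo A) : 0 ≤ ‖x‖ := Real.sqrt_nonneg _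

theorem norm_ellInner_le (x y : EllTwo A) : ‖ellInner x y‖ ≤ ‖x‖ * ‖y‖ := by
  have h : ‖ellInner x y‖ ^ 2 ≤ ‖ellInner x x‖ * ‖ellInner y y‖ :=
    le_of_tendsto_of_tendsto ((Tendsto.norm (hasSum_ellInner x y)).pow 2)
      ((Tendsto.norm (hasSum_ellInner x x)).mul (Tendsto.norm (hasSum_ellInner y y)))
      (Eventually.of_forall fun s => norm_sum_star_mul_sq_le s x.1 y.1)
  rw [← ellNorm_sq, ← ellNorm_sq, ← mul_pow] at h
  exact le_of_sq_le_sq h (mul_nonneg (ellNorm_nonneg _) (ellNorm_nonneg _))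

theorem star_ellInner (x y : EllTwo A) : star (ellInner x y) = ellInner y x := by
  refine (hasSum_ellInner x y).star.unique ?_
  simpa using hasSum_ellInner y x

theorem ellInner_add_left (x y z : EllTwo A) :
    ellInner (x + y) z = ellInner x z + ellInner y z := by
  refine (hasSum_ellInner _ _).unique ?_
  simpa [add_mul] using (hasSum_ellInner x z).add (hasSum_ellInner y z)

theorem ellInner_add_right (x y z : EllTwo A) :
    ellInner x (y + z) = ellInner x y + ellInner x z := by
  refine (hasSum_ellInner _ _).unique ?_
  simpa [mul_add] using (hasSum_ellInner x y).add (hasSum_ellInner x z)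

theorem ellInner_smul_left (c : ℂ) (x y : EllTwo A) :
    ellInner (c • x) y = star c • ellInner x y := by
  refine (hasSum_ellInner _ _).unique ?_
  simpa [smul_mul_assoc] using (hasSum_ellInner x y).const_smul (star c)

theorem ellInner_smul_right (c : ℂ) (x y : EllTwo A) :
    ellInner x (c • y) = c • ellInner x y := by
  refine (hasSum_ellInner _ _).unique ?_
  simpa [mul_smul_comm] using (hasSum_ellInner x y).const_smul c

theorem ellNorm_add_sq_le (x y : EllTwo A) : ‖x + y‖ ^ 2 ≤ 2 * (‖x‖ ^ 2 + ‖y‖ ^ 2) := by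
  simp only [ellNorm_sq]
  exact le_of_tendsto_of_tendsto (Tendsto.norm (hasSum_ellInner (x + y) (x + y)))
    (((Tendsto.norm (hasSum_ellInner x x)).add
      (Tendsto.norm (hasSum_ellInner y y))).const_mul 2)
    (Eventually.of_forall fun s => norm_sum_star_add_le s x.1 y.1)

/-- The element of `ℓ₂(A)` with entry `a` in place `i` and `0` elsewhere. -/
def ellSingle (i : ℕ) (a : A) : EllTwo A :=
  ⟨Pi.single i a, summable_of_ne_finset_zero (s := {i}) fun j hj => by
    rw [Pi.single_eq_of_ne (by simpa using hj)]; simp⟩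

theorem ellInner_single_left (i : ℕ) (a : A) (x : EllTwo A) :
    ellInner (ellSingle i a) x = star a * x.1 i := by
  refine (hasSum_ellInner _ _).unique ?_
  convert hasSum_single i fun j hj => ?_ using 1
  · simp [ellSingle]
  · simp [ellSingle, Pi.single_eq_of_ne hj]

/-! ### The multiplier module `M(ℓ₂(A))` -/

variable (A) in
/-- The multiplier module `M(ℓ₂(A))`: all adjointable maps `r : A → ℓ₂(A)`, that is, bounded
`A`-linear maps for which there is `s : ℓ₂(A) → A` with `⟨r a, x⟩ = ⟨a, s x⟩ = a* (s x)`. -/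
def MulEllTwo : Submodule ℂ (A →ₗ[ℂ] EllTwo A) where
  carrier := {r | (∀ a b i, (r (a * b)).1 i = (r a).1 i * b) ∧
    (∃ C : ℝ, ∀ a, ‖r a‖ ≤ C * ‖a‖) ∧
    ∃ s : EllTwo A → A, ∀ a x, ellInner (r a) x = star a * s x}
  zero_mem' := by
    refine ⟨by simp, ⟨0, fun a => ?_⟩, ⟨0, fun a x => ?_⟩⟩
    · have h : ellInner (0 : EllTwo A) 0 = 0 := by simp [ellInner]
      have h' : ‖(0 : EllTwo A)‖ = 0 := by simp [norm, h]
      simp [h']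
    · simp [ellInner]
  add_mem' {r t} hr ht := by
    obtain ⟨h1, ⟨C, hC⟩, s, hs⟩ := hr
    obtain ⟨k1, ⟨D, hD⟩, u, hu⟩ := ht
    refine ⟨fun a b i => ?_, ⟨2 * (|C| + |D|), fun a => ?_⟩, ⟨s + u, fun a x => ?_⟩⟩
    · simp [h1, k1, add_mul]
    · have p : ‖r a‖ ≤ |C| * ‖a‖ := (hC a).trans (by gcongr; exact le_abs_self _)
      have q : ‖t a‖ ≤ |D| * ‖a‖ := (hD a).trans (by gcongr; exact le_abs_self _)
      have e := ellNorm_add_sq_le (r a) (t a)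
      have n1 := ellNorm_nonneg (r a)
      have n2 := ellNorm_nonneg (t a)
      have hle : ‖r a + t a‖ ≤ 2 * (‖r a‖ + ‖t a‖) :=
        le_of_sq_le_sq (e.trans (by nlinarith [mul_nonneg n1 n2])) (by positivity)
      rw [LinearMap.add_apply]
      linarith
    · rw [LinearMap.add_apply, ellInner_add_left, hs, hu, Pi.add_apply, mul_add]
  smul_mem' c r hr := by
    obtain ⟨h1, ⟨C, hC⟩, s, hs⟩ := hr
    refine ⟨fun a b i => ?_, ⟨‖c‖ * C, fun a => ?_⟩, ⟨fun x => star c • s x, fun a x => ?_⟩⟩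
    · simp [h1, smul_mul_assoc]
    · have : ‖c • r a‖ = ‖c‖ * ‖r a‖ := by
        have h : ‖c • r a‖ ^ 2 = (‖c‖ * ‖r a‖) ^ 2 := by
          rw [mul_pow, ellNorm_sq, ellNorm_sq, ellInner_smul_left, ellInner_smul_right, norm_smul,
            norm_smul, norm_star]
          ring
        exact (pow_left_inj₀ (ellNorm_nonneg _)
          (mul_nonneg (norm_nonneg _) (ellNorm_nonneg _)) two_ne_zero).1 h
      rw [LinearMap.smul_apply, this, mul_assoc]
      exact mul_le_mul_of_nonneg_left (hC a) (norm_nonneg c)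
    · rw [LinearMap.smul_apply, ellInner_smul_left, hs, mul_smul_comm]

theorem eq_of_star_mul_eq {s t : A} (h : ∀ a : A, star a * s = star a * t) : s = t := by
  have h' := h (s - t)
  rw [← sub_eq_zero, ← mul_sub, CStarRing.star_mul_self_eq_zero_iff] at h'
  exact sub_eq_zero.1 h'

/-- The adjoint `r* : ℓ₂(A) → A` of `r ∈ M(ℓ₂(A))`. -/
def adj (r : MulEllTwo A) : EllTwo A → A := r.2.2.2.choose

theorem ellInner_apply (r : MulEllTwo A) (a : A) (x : EllTwo A) :
    ellInner (r.1 a) x = star a * adj r x :=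
  r.2.2.2.choose_spec a x

theorem adj_eq {r : MulEllTwo A} {x : EllTwo A} {s : A}
    (h : ∀ a, ellInner (r.1 a) x = star a * s) : adj r x = s :=
  eq_of_star_mul_eq fun a => by rw [← ellInner_apply, h]

/-- The map `r₁* r₂ : A → A`, as a bounded operator. -/
def adjComp (r₁ r₂ : MulEllTwo A) : A →L[ℂ] A :=
  LinearMap.mkContinuousOfExistsBound
    { toFun := fun a => adj r₁ (r₂.1 a)
      map_add' := fun a b => adj_eq fun c => by
        rw [map_add, ellInner_add_right, ellInner_apply, ellInner_apply, mul_add]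
      map_smul' := fun c a => adj_eq fun b => by
        rw [map_smul, ellInner_smul_right, ellInner_apply, mul_smul_comm, RingHom.id_apply] }
    (by
      obtain ⟨C, hC⟩ := r₁.2.2.1
      obtain ⟨D, hD⟩ := r₂.2.2.1
      refine ⟨|C| * |D|, fun a => ?_⟩
      change ‖adj r₁ (r₂.1 a)‖ ≤ _
      set t := adj r₁ (r₂.1 a) with ht
      have h1 : ‖t‖ * ‖t‖ ≤ ‖t‖ * (|C| * |D| * ‖a‖) := by
        rw [← CStarRing.norm_star_mul_self, ht, ← ellInner_apply, ← ht]
        calc ‖ellInner (r₁.1 t) (r₂.1 a)‖ ≤ ‖r₁.1 t‖ * ‖r₂.1 a‖ := norm_ellInner_le _ _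
          _ ≤ (|C| * ‖t‖) * (|D| * ‖a‖) := by
            refine mul_le_mul ((hC t).trans ?_) ((hD a).trans ?_) (ellNorm_nonneg _) (by positivity)
            · gcongr; exact le_abs_self _
            · gcongr; exact le_abs_self _
          _ = ‖t‖ * (|C| * |D| * ‖a‖) := by ring
      rcases (norm_nonneg t).eq_or_lt with h | h
      · rw [← h]; positivity
      · exact le_of_mul_le_mul_left h1 h)

theorem adjComp_apply (r₁ r₂ : MulEllTwo A) (a : A) : adjComp r₁ r₂ a = adj r₁ (r₂.1 a) := rfl

/-- The `M(A)`-valued inner product `⟨r₁, r₂⟩ = r₁* r₂` on `M(ℓ₂(A))`. As a double centralizer, its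
left multiplication is `a ↦ r₁* (r₂ a)` and its right multiplication is `a ↦ (r₂* (r₁ a*))*`. -/
def mulInner (r₁ r₂ : MulEllTwo A) : 𝓜(ℂ, A) where
  fst := adjComp r₁ r₂
  snd := ((starₗᵢ ℂ : A ≃ₗᵢ⋆[ℂ] A) : A →L⋆[ℂ] A).comp
    ((adjComp r₂ r₁).comp ((starₗᵢ ℂ : A ≃ₗᵢ⋆[ℂ] A) : A →L⋆[ℂ] A))
  central x y := by
    change star (adj r₂ (r₁.1 (star x))) * y = x * adj r₁ (r₂.1 y)
    have h1 : star y * adj r₂ (r₁.1 (star x)) = ellInner (r₂.1 y) (r₁.1 (star x)) :=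
      (ellInner_apply _ _ _).symm
    have h2 : x * adj r₁ (r₂.1 y) = ellInner (r₁.1 (star x)) (r₂.1 y) := by
      rw [ellInner_apply, star_star]
    rw [h2, ← star_ellInner, ← h1, star_mul, star_star]

/-- The norm `‖r‖ = ‖⟨r, r⟩‖ ^ (1/2)` of the Hilbert `M(A)`-module `M(ℓ₂(A))`. -/
instance : Norm (MulEllTwo A) := ⟨fun r => √‖mulInner r r‖⟩

/-- The right action of `M(A)` on `M(ℓ₂(A))`: `(r m)(a) = r (m a)`. -/
instance : SMul 𝓜(ℂ, A)ᵐᵒᵖ (MulEllTwo A) where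
  smul m r := ⟨r.1.comp m.unop.fst.toLinearMap, by
    obtain ⟨h1, ⟨C, hC⟩, s, hs⟩ := r.2
    have hm : ∀ a b, m.unop.fst (a * b) = m.unop.fst a * b := fun a b =>
      eq_of_star_mul_eq fun c => by
        rw [← m.unop.central, ← mul_assoc, m.unop.central, mul_assoc]
    refine ⟨fun a b i => ?_, ⟨|C| * ‖m.unop.fst‖, fun a => ?_⟩,
      ⟨fun x => (star m.unop).fst (s x), fun a x => ?_⟩⟩
    · change (r.1 (m.unop.fst (a * b))).1 i = (r.1 (m.unop.fst a)).1 i * b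
      rw [hm, h1]
    · change ‖r.1 (m.unop.fst a)‖ ≤ _
      refine (hC _).trans ?_
      rw [mul_assoc]
      exact mul_le_mul (le_abs_self _) (m.unop.fst.le_opNorm a) (norm_nonneg _) (abs_nonneg _)
    · change ellInner (r.1 (m.unop.fst a)) x = _
      rw [hs, ← (star m.unop).central, DoubleCentralizer.star_snd, star_star]⟩

theorem op_smul_apply (m : 𝓜(ℂ, A)) (r : MulEllTwo A) (a : A) :
    (MulOpposite.op m • r).1 a = r.1 (m.fst a) := rfl

instance : Module 𝓜(ℂ, A)ᵐᵒᵖ (MulEllTwo A) where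
  one_smul r := rfl
  mul_smul m n r := rfl
  smul_zero m := rfl
  smul_add m r t := rfl
  add_smul m n r := Subtype.ext (LinearMap.ext fun a => map_add r.1 _ _)
  zero_smul r := Subtype.ext (LinearMap.ext fun a => map_zero r.1)

/-- The inclusion `a ↦ (0, …, 0, a, 0, …)` of `A` into `ℓ₂(A)` at place `i`, an element of
`M(ℓ₂(A))`. -/
def basisMul (i : ℕ) : MulEllTwo A :=
  ⟨{ toFun := ellSingle i
     map_add' := fun a b => Subtype.ext (Pi.single_add (f := fun _ => A) i a b)
     map_smul' := fun c a => Subtype.ext (Pi.single_smul (f := fun _ => A) i c a) }, by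
    refine ⟨fun a b j => ?_, ⟨1, fun a => ?_⟩, ⟨fun x => x.1 i, fun a x => ?_⟩⟩
    · change (Pi.single i (a * b) : ℕ → A) j = (Pi.single i a : ℕ → A) j * b
      by_cases h : j = i
      · subst h; simp
      · simp [Pi.single_eq_of_ne h]
    · change √‖ellInner (ellSingle i a) (ellSingle i a)‖ ≤ _
      rw [ellInner_single_left]
      have : (ellSingle i a).1 i = a := by simp [ellSingle]
      rw [this, CStarRing.norm_star_mul_self, Real.sqrt_mul_self (norm_nonneg _), one_mul]
    · exact ellInner_single_left i a x⟩

/-- The coordinates `βᵢ ∈ M(A)` of `β ∈ M(ℓ₂(A))`: left multiplication by `βᵢ` is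
`a ↦ (β a)ᵢ`. -/
def coord (β : MulEllTwo A) (i : ℕ) : 𝓜(ℂ, A) := mulInner (basisMul i) β

theorem coord_fst (β : MulEllTwo A) (i : ℕ) (a : A) : (coord β i).fst a = (β.1 a).1 i :=
  adj_eq (r := basisMul i) fun b => ellInner_single_left i b (β.1 a)

/-! ### The dual module `(M(ℓ₂(A)))'` -/

variable (A) in
/-- The dual module `(M(ℓ₂(A)))'`: the bounded `M(A)`-linear maps `M(ℓ₂(A)) → M(A)`. -/
def Dual : AddSubgroup (MulEllTwo A →ₗ[𝓜(ℂ, A)ᵐᵒᵖ] 𝓜(ℂ, A)) where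
  carrier := {F | ∃ C : ℝ, ∀ β, ‖F β‖ ≤ C * ‖β‖}
  zero_mem' := ⟨0, by simp⟩
  add_mem' := by
    rintro F G ⟨C, hC⟩ ⟨D, hD⟩
    exact ⟨C + D, fun β => (norm_add_le _ _).trans (by rw [add_mul]; exact add_le_add (hC β) (hD β))⟩
  neg_mem' := by
    rintro F ⟨C, hC⟩
    exact ⟨C, fun β => by simpa using hC β⟩

/-- The right action of `M(A)` on the dual module: `(F m)(β) = m* F(β)`. -/
instance : SMul 𝓜(ℂ, A)ᵐᵒᵖ (Dual A) where
  smul m F := ⟨{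
    toFun := fun β => star m.unop * F.1 β
    map_add' := fun β γ => by rw [map_add, mul_add]
    map_smul' := fun n β => by
      rw [map_smul, RingHom.id_apply, MulOpposite.smul_eq_mul_unop, MulOpposite.smul_eq_mul_unop,
        mul_assoc] }, by
    obtain ⟨C, hC⟩ := F.2
    refine ⟨‖m.unop‖ * C, fun β => ?_⟩
    refine (norm_mul_le _ _).trans ?_
    rw [norm_star, mul_assoc]
    exact mul_le_mul_of_nonneg_left (hC β) (norm_nonneg _)⟩

theorem dual_smul_apply (m : 𝓜(ℂ, A)) (F : Dual A) (β : MulEllTwo A) :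
    (MulOpposite.op m • F).1 β = star m * F.1 β := rfl

instance : Module 𝓜(ℂ, A)ᵐᵒᵖ (Dual A) where
  one_smul F := Subtype.ext (LinearMap.ext fun β => by
    change star (1 : 𝓜(ℂ, A)) * F.1 β = F.1 β
    rw [star_one, one_mul])
  mul_smul m n F := Subtype.ext (LinearMap.ext fun β => by
    change star (n.unop * m.unop) * F.1 β = star m.unop * (star n.unop * F.1 β)
    rw [star_mul, mul_assoc])
  smul_zero m := Subtype.ext (LinearMap.ext fun β => mul_zero (star m.unop))
  smul_add m F G := Subtype.ext (LinearMap.ext fun β => mul_add (star m.unop) _ _)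
  add_smul m n F := Subtype.ext (LinearMap.ext fun β => by
    change star (m.unop + n.unop) * F.1 β = star m.unop * F.1 β + star n.unop * F.1 β
    rw [star_add, add_mul])
  zero_smul F := Subtype.ext (LinearMap.ext fun β => by
    change star (0 : 𝓜(ℂ, A)) * F.1 β = 0
    rw [star_zero, zero_mul])

/-! ### Left multipliers and left strict convergence -/

variable (A) in
/-- The left multipliers `LM(A)`: bounded operators `u` on `A` with `u (a b) = (u a) b`. -/
def LeftMul : Submodule ℂ (A →L[ℂ] A) where
  carrier := {u | ∀ a b, u (a * b) = u a * b}
  zero_mem' := by simp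
  add_mem' {u v} hu hv := fun a b => by
    simp only [add_apply, hu a b, hv a b, add_mul]
  smul_mem' c u hu := fun a b => by
    simp only [smul_apply, hu a b, smul_mul_assoc]

/-- The inclusion `M(A) ⊆ LM(A)`. -/
def toLeftMul (m : 𝓜(ℂ, A)) : LeftMul A :=
  ⟨m.fst, fun a b => eq_of_star_mul_eq fun c => by
    rw [← m.central, ← mul_assoc, m.central, mul_assoc]⟩

/-- Left strict convergence of a sequence in `LM(A)`: `uₙ a → u a` in norm for all `a ∈ A`. -/
def LeftStrictTendsto (u : ℕ → LeftMul A) (v : LeftMul A) : Prop :=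
  ∀ a : A, Tendsto (fun n => (u n).1 a) atTop (𝓝 (v.1 a))

/-- The `n`-th partial sum of `∑ αᵢ* βᵢ`, as an element of `LM(A)`. -/
def partialSum (α : ℕ → 𝓜(ℂ, A)) (β : MulEllTwo A) (n : ℕ) : LeftMul A :=
  toLeftMul (∑ i ∈ Finset.range n, star (α i) * coord β i)

/-- The partial sums of `∑ αᵢ* αᵢ` are bounded in norm. -/
def BoundedPartialSums (α : ℕ → 𝓜(ℂ, A)) : Prop :=
  ∃ C : ℝ, ∀ n : ℕ, ‖∑ i ∈ Finset.range n, star (α i) * α i‖ ≤ C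

/-- The three conditions on a sequence in `M(A)`. -/
structure IsDualSeq (α : ℕ → 𝓜(ℂ, A)) : Prop where
  bounded : BoundedPartialSums α
  converges : ∀ β : MulEllTwo A, ∃ u : LeftMul A, LeftStrictTendsto (partialSum α β) u
  limit_mem : ∀ (β : MulEllTwo A) (u : LeftMul A), LeftStrictTendsto (partialSum α β) u →
    ∃ m : 𝓜(ℂ, A), u = toLeftMul m

theorem LeftStrictTendsto.unique {u : ℕ → LeftMul A} {v w : LeftMul A}
    (hv : LeftStrictTendsto u v) (hw : LeftStrictTendsto u w) : v = w :=
  Subtype.ext (ContinuousLinearMap.ext fun a => tendsto_nhds_unique (hv a) (hw a))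

theorem toLeftMul_apply (m : 𝓜(ℂ, A)) (a : A) : (toLeftMul m).1 a = m.fst a := rfl

theorem isDualSeq_of_limits {α : ℕ → 𝓜(ℂ, A)} (h : BoundedPartialSums α)
    (h' : ∀ β : MulEllTwo A, ∃ m, LeftStrictTendsto (partialSum α β) (toLeftMul m)) :
    IsDualSeq α where
  bounded := h
  converges β := (h' β).imp' toLeftMul fun _ hm => hm
  limit_mem β u hu := by
    obtain ⟨m, hm⟩ := h' β
    exact ⟨m, hu.unique hm⟩

theorem IsDualSeq.exists_limit {α : ℕ → 𝓜(ℂ, A)} (h : IsDualSeq α) (β : MulEllTwo A) :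
    ∃ m, LeftStrictTendsto (partialSum α β) (toLeftMul m) := by
  obtain ⟨u, hu⟩ := h.converges β
  obtain ⟨m, rfl⟩ := h.limit_mem β u hu
  exact ⟨m, hu⟩

variable (A) in
/-- The right `M(A)`-module of all sequences in `M(A)` that satisfy the three conditions, with the
entrywise operations `(α + α')ᵢ = αᵢ + α'ᵢ` and `(α m)ᵢ = αᵢ m`. -/
def DualSeq : Submodule 𝓜(ℂ, A)ᵐᵒᵖ (ℕ → 𝓜(ℂ, A)) where
  carrier := {α | IsDualSeq α}
  zero_mem' := by
    refine isDualSeq_of_limits ⟨0, by simp⟩ fun β => ⟨0, fun a => ?_⟩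
    simp [partialSum]
  add_mem' {α α'} hα hα' := by
    obtain ⟨C, hC⟩ := hα.bounded
    obtain ⟨D, hD⟩ := hα'.bounded
    refine isDualSeq_of_limits ⟨2 * (C + D), fun n => ?_⟩ fun β => ?_
    · refine (norm_sum_star_add_le _ _ _).trans ?_
      linarith [hC n, hD n]
    · obtain ⟨m, hm⟩ := hα.exists_limit β
      obtain ⟨m', hm'⟩ := hα'.exists_limit β
      refine ⟨m + m', fun a => ?_⟩
      have e : ∀ n, (partialSum (α + α') β n).1 a =
          (partialSum α β n).1 a + (partialSum α' β n).1 a := fun n => by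
        simp only [partialSum, toLeftMul_apply, Pi.add_apply, star_add, add_mul,
          Finset.sum_add_distrib, DoubleCentralizer.add_fst, add_apply]
      simp only [e]
      exact (hm a).add (hm' a)
  smul_mem' m α hα := by
    obtain ⟨C, hC⟩ := hα.bounded
    refine isDualSeq_of_limits ⟨‖m.unop‖ * C * ‖m.unop‖, fun n => ?_⟩ fun β => ?_
    · have e : ∑ i ∈ Finset.range n, star ((m • α) i) * (m • α) i =
          star m.unop * (∑ i ∈ Finset.range n, star (α i) * α i) * m.unop := by
        rw [Finset.mul_sum, Finset.sum_mul]
        refine Finset.sum_congr rfl fun i _ => ?_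
        rw [Pi.smul_apply, MulOpposite.smul_eq_mul_unop, star_mul]
        simp only [mul_assoc]
      rw [e]
      refine (norm_mul_le _ _).trans (mul_le_mul_of_nonneg_right ?_ (norm_nonneg _))
      refine (norm_mul_le _ _).trans ?_
      rw [norm_star]
      exact mul_le_mul_of_nonneg_left (hC n) (norm_nonneg _)
    · obtain ⟨l, hl⟩ := hα.exists_limit β
      refine ⟨star m.unop * l, fun a => ?_⟩
      have e : ∀ n, (partialSum (m • α) β n).1 a =
          (star m.unop).fst ((partialSum α β n).1 a) := fun n => by
        have : ∑ i ∈ Finset.range n, star ((m • α) i) * coord β i =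
            star m.unop * ∑ i ∈ Finset.range n, star (α i) * coord β i := by
          rw [Finset.mul_sum]
          refine Finset.sum_congr rfl fun i _ => ?_
          rw [Pi.smul_apply, MulOpposite.smul_eq_mul_unop, star_mul, mul_assoc]
        simp only [partialSum, toLeftMul_apply, this]
        rfl
      simp only [e]
      exact ((star m.unop).fst.continuous.tendsto _).comp (hl a)

/-! ### Strong convergence in a representation -/

variable {H : Type*} [NormedAddCommGroup H] [InnerProductSpace ℂ H] [CompleteSpace H]

/-- A representation of `A` on `H` is non-degenerate if the vectors `π(a) h` span a dense
subspace. -/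
def Nondegenerate (π : A →⋆ₙₐ[ℂ] (H →L[ℂ] H)) : Prop :=
  Dense (Submodule.span ℂ {ξ : H | ∃ (a : A) (h : H), ξ = π a h} : Set H)

/-- The map `f ↦ ∑ π(a) f(a)` on finitely supported functions `A → H`. -/
def repSum (π : A →⋆ₙₐ[ℂ] (H →L[ℂ] H)) : (A →₀ H) →ₗ[ℂ] H :=
  Finsupp.lsum ℂ fun a => (π a).toLinearMap

/-- The map `f ↦ ∑ π(m a) f(a)` on finitely supported functions `A → H`. -/
def repSumMul (π : A →⋆ₙₐ[ℂ] (H →L[ℂ] H)) (m : 𝓜(ℂ, A)) : (A →₀ H) →ₗ[ℂ] H :=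
  Finsupp.lsum ℂ fun a => (π (m.fst a)).toLinearMap

/-- The operator on `H` by which `m ∈ M(A)` acts: the bounded operator with
`π(a) h ↦ π(m a) h`. -/
def extendRep (π : A →⋆ₙₐ[ℂ] (H →L[ℂ] H)) (m : 𝓜(ℂ, A)) : H →L[ℂ] H :=
  LinearMap.extendOfNorm (repSumMul π m) (repSum π)

theorem denseRange_repSum {π : A →⋆ₙₐ[ℂ] (H →L[ℂ] H)} (hπ : Nondegenerate π) :
    DenseRange (repSum π) := by
  refine Dense.mono ?_ hπ
  have : Submodule.span ℂ {ξ : H | ∃ (a : A) (h : H), ξ = π a h} ≤ LinearMap.range (repSum π) := by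
    rw [Submodule.span_le]
    rintro _ ⟨a, h, rfl⟩
    exact ⟨Finsupp.single a h, by simp [repSum]⟩
  intro ξ hξ
  exact this hξ

theorem norm_repSumMul_le (π : A →⋆ₙₐ[ℂ] (H →L[ℂ] H)) (m : 𝓜(ℂ, A)) (f : A →₀ H) :
    ‖repSumMul π m f‖ ≤ ‖m‖ * ‖repSum π f‖ := by
  let _ : PartialOrder A := CStarAlgebra.spectralOrder A
  have : StarOrderedRing A := CStarAlgebra.spectralOrderedRing A
  have hu := CStarAlgebra.increasingApproximateUnit A
  have : (CStarAlgebra.approximateUnit A).NeBot := hu.neBot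
  have hc : Continuous π := map_continuous π
  have hmul : ∀ u a : A, m.fst (u * a) = m.fst u * a := (toLeftMul m).2
  have key : ∀ u : A, π (m.fst u) (repSum π f) = f.sum fun a h => π (m.fst (u * a)) h := by
    intro u
    simp only [repSum, Finsupp.lsum_apply, Finsupp.sum, map_sum, hmul, map_mul]
    rfl
  have hlim : Tendsto (fun u => π (m.fst u) (repSum π f)) (CStarAlgebra.approximateUnit A)
      (𝓝 (repSumMul π m f)) := by
    simp only [key]
    refine tendsto_finsetSum _ fun a _ => ?_
    have h1 : Tendsto (fun u => u * a) (CStarAlgebra.approximateUnit A) (𝓝 a) :=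
      hu.tendsto_mul_right a
    have h2 : Continuous fun b : A => π (m.fst b) (f a) :=
      (hc.comp m.fst.continuous).clm_apply continuous_const
    exact (h2.tendsto a).comp h1
  refine le_of_tendsto hlim.norm ?_
  filter_upwards [hu.eventually_norm] with u hu1
  refine ((π (m.fst u)).le_opNorm _).trans (mul_le_mul_of_nonneg_right ?_ (norm_nonneg _))
  refine (NonUnitalStarAlgHom.norm_apply_le π _).trans ?_
  refine (m.fst.le_opNorm u).trans ?_
  rw [DoubleCentralizer.norm_fst]
  exact mul_le_of_le_one_right (norm_nonneg _) hu1

theorem extendRep_apply {π : A →⋆ₙₐ[ℂ] (H →L[ℂ] H)} (hπ : Nondegenerate π) (m : 𝓜(ℂ, A))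
    (a : A) (h : H) : extendRep π m (π a h) = π (m.fst a) h := by
  have e := LinearMap.extendOfNorm_eq (denseRange_repSum hπ) ⟨‖m‖, norm_repSumMul_le π m⟩
    (Finsupp.single a h)
  simpa [repSum, repSumMul, extendRep] using e

/-- The series `∑ αᵢ* αᵢ` converges strongly in `B(H)`, where `M(A)` acts on `H` through the
representation `π` of `A`. -/
def StronglyConvergent (π : A →⋆ₙₐ[ℂ] (H →L[ℂ] H)) (α : ℕ → 𝓜(ℂ, A)) : Prop :=
  ∃ S : H →L[ℂ] H, ∀ h : H,
    Tendsto (fun n => ∑ i ∈ Finset.range n, extendRep π (star (α i) * α i) h) atTop (𝓝 (S h))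

end

end MultiplierDual

/-! A functional `F` is represented by `αᵢ = F(eᵢ)*`, where `eᵢ` is the `i`-th coordinate inclusion.
The truncations of `β ∈ M(ℓ₂(A))` need not converge to `β` in norm, but after multiplication by
`a ∈ A` they do, since `β a ∈ ℓ₂(A)`. As `F(γ) a = F(γ a)` for `γ ∈ M(ℓ₂(A))`, the partial sums of
`∑ αᵢ* βᵢ` converge to `F(β)` left strictly. Conversely, the partial sums of `∑ αᵢ* βᵢ` are inner
products with the truncations of `α`, whose norms are bounded, so by the Cauchy–Schwarz inequality
they are uniformly bounded functionals and their left strict limit is again one.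

Faithfulness of `π` makes its extension to `M(A)` isometric. Bounded partial sums of `∑ αᵢ* αᵢ` thus
give a bounded increasing sequence of operators, which converges strongly, and strong convergence
gives boundedness by the uniform boundedness principle. -/

namespace MultiplierDual

section MonotoneOperators

section

variable {𝕜 H : Type*} [RCLike 𝕜] [NormedAddCommGroup H] [InnerProductSpace 𝕜 H]

theorem reApplyInnerSelf_sub (S T : H →L[𝕜] H) (x : H) :
    (S - T).reApplyInnerSelf x = S.reApplyInnerSelf x - T.reApplyInnerSelf x := by
  simp only [ContinuousLinearMap.reApplyInnerSelf_apply, sub_apply, inner_sub_left, map_sub]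

theorem monotone_reApplyInnerSelf (x : H) :
    Monotone fun T : H →L[𝕜] H => T.reApplyInnerSelf x := fun S T hST => by
  rw [← sub_nonneg, ← reApplyInnerSelf_sub]
  exact ((ContinuousLinearMap.le_def S T).1 hST).re_inner_nonneg_left x

theorem reApplyInnerSelf_le (T : H →L[𝕜] H) (x : H) : T.reApplyInnerSelf x ≤ ‖T‖ * ‖x‖ ^ 2 :=
  calc T.reApplyInnerSelf x ≤ ‖T x‖ * ‖x‖ := re_inner_le_norm _ _
    _ ≤ ‖T‖ * ‖x‖ * ‖x‖ := by gcongr; exact T.le_opNorm x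
    _ = ‖T‖ * ‖x‖ ^ 2 := by ring

end

variable {H : Type*} [NormedAddCommGroup H] [InnerProductSpace ℂ H] [CompleteSpace H]

theorem norm_apply_sq_le_of_nonneg {T : H →L[ℂ] H} (hT : 0 ≤ T) (x : H) :
    ‖T x‖ ^ 2 ≤ ‖T‖ * T.reApplyInnerSelf x := by
  obtain ⟨S, rfl⟩ := CStarAlgebra.nonneg_iff_eq_star_mul_self.1 hT
  have hinner : (star S * S).reApplyInnerSelf x = ‖S x‖ ^ 2 := by
    rw [ContinuousLinearMap.reApplyInnerSelf_apply, mul_apply_eq_comp,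
      ContinuousLinearMap.star_eq_adjoint, ContinuousLinearMap.adjoint_inner_left,
      inner_self_eq_norm_sq]
  calc ‖(star S * S) x‖ ^ 2 ≤ (‖star S‖ * ‖S x‖) ^ 2 := by
        gcongr
        exact (star S).le_opNorm (S x)
    _ = ‖star S * S‖ * (star S * S).reApplyInnerSelf x := by
        rw [hinner, CStarRing.norm_star_mul_self, norm_star]
        ring

variable {ι : Type*} [Nonempty ι] [SemilatticeSup ι] {T : ι → H →L[ℂ] H} {C : ℝ}

theorem cauchySeq_apply_of_monotone_of_norm_le (hT : Monotone T) (hC : ∀ i, ‖T i‖ ≤ C) (x : H) :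
    CauchySeq fun i => T i x := by
  let f : ι → ℝ := fun i => (T i).reApplyInnerSelf x
  have hf_mono : Monotone f := (monotone_reApplyInnerSelf x).comp hT
  have hf_bdd : BddAbove (Set.range f) := ⟨C * ‖x‖ ^ 2, by
    rintro _ ⟨i, rfl⟩
    exact (reApplyInnerSelf_le (T i) x).trans (by gcongr; exact hC i)⟩
  obtain ⟨L, hL⟩ : ∃ L, Tendsto f atTop (𝓝 L) := ⟨_, tendsto_atTop_ciSup hf_mono hf_bdd⟩
  have norm_sub_le (i j : ι) : ‖T j - T i‖ ≤ C + C := norm_sub_le_of_le (hC j) (hC i)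
  have dist_sq_le {i j : ι} (hij : i ≤ j) : ‖T j x - T i x‖ ^ 2 ≤ (C + C) * (L - f i) :=
    calc ‖T j x - T i x‖ ^ 2 ≤ ‖T j - T i‖ * (f j - f i) := by
          rw [← reApplyInnerSelf_sub, ← sub_apply]
          exact norm_apply_sq_le_of_nonneg (sub_nonneg.2 (hT hij)) x
      _ ≤ (C + C) * (L - f i) := by
          gcongr
          · exact sub_nonneg.2 (hf_mono hij)
          · exact (norm_nonneg _).trans (norm_sub_le i j)
          · exact norm_sub_le i j
          · exact hf_mono.ge_of_tendsto hL j
  refine cauchySeq_of_le_tendsto_0' (fun i => √((C + C) * (L - f i))) (fun i j hij => ?_) ?_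
  · rw [dist_comm, dist_eq_norm]
    exact Real.le_sqrt_of_sq_le (dist_sq_le hij)
  · simpa using ((hL.const_sub L).const_mul (C + C)).sqrt

theorem exists_tendsto_apply_of_monotone_of_norm_le (hT : Monotone T) (hC : ∀ i, ‖T i‖ ≤ C) :
    ∃ S : H →L[ℂ] H, ∀ x, Tendsto (fun i => T i x) atTop (𝓝 (S x)) := by
  choose S hS using fun x =>
    cauchySeq_tendsto_of_complete (cauchySeq_apply_of_monotone_of_norm_le hT hC x)
  have hbounded : Bornology.IsBounded (Set.range T) :=
    isBounded_iff_forall_norm_le.2 ⟨C, Set.forall_mem_range.2 hC⟩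
  exact ⟨ContinuousLinearMap.ofTendstoOfBoundedRange S T (tendsto_pi_nhds.2 hS) hbounded, hS⟩

end MonotoneOperators

theorem exists_norm_le_of_tendsto_apply {𝕜 E F : Type*} [NontriviallyNormedField 𝕜]
    [NormedAddCommGroup E] [NormedSpace 𝕜 E] [CompleteSpace E] [NormedAddCommGroup F]
    [NormedSpace 𝕜 F] {T : ℕ → E →L[𝕜] F} {S : E → F}
    (h : ∀ x, Tendsto (fun n => T n x) atTop (𝓝 (S x))) : ∃ C, ∀ n, ‖T n‖ ≤ C :=
  banach_steinhaus fun x =>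
    (h x).norm.bddAbove_range.imp fun _ hC n => hC (Set.mem_range_self n)

section DoubleCentralizers

variable {A : Type*} [NonUnitalCStarAlgebra A]

theorem norm_toLeftMul (m : 𝓜(ℂ, A)) : ‖toLeftMul m‖ = ‖m‖ := DoubleCentralizer.norm_fst m

theorem toLeftMul_injective : Function.Injective (toLeftMul : 𝓜(ℂ, A) → LeftMul A) :=
  fun m n h => by
    have hsub : toLeftMul (m - n) = toLeftMul m - toLeftMul n := rfl
    rw [← sub_eq_zero, ← norm_eq_zero, ← norm_toLeftMul, hsub, h, sub_self]
    exact norm_zero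

theorem ext_fst {m n : 𝓜(ℂ, A)} (h : ∀ a, m.fst a = n.fst a) : m = n :=
  toLeftMul_injective (Subtype.ext (ContinuousLinearMap.ext h))

theorem sum_fst_apply {ι : Type*} (s : Finset ι) (m : ι → 𝓜(ℂ, A)) (a : A) :
    (∑ i ∈ s, m i).fst a = ∑ i ∈ s, (m i).fst a :=
  map_sum (⟨⟨fun m => m.fst a, rfl⟩, fun _ _ => rfl⟩ : 𝓜(ℂ, A) →+ A) m s

theorem star_fst_mul (m : 𝓜(ℂ, A)) (a b : A) :
    star ((star m).fst a) * b = star a * m.fst b := by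
  rw [DoubleCentralizer.star_fst, star_star, m.central]

theorem mul_coe (m : 𝓜(ℂ, A)) (a : A) : m * (a : 𝓜(ℂ, A)) = (m.fst a : 𝓜(ℂ, A)) :=
  ext_fst fun b => (toLeftMul m).2 a b

theorem norm_coe (a : A) : ‖(a : 𝓜(ℂ, A))‖ = ‖a‖ := by
  rw [← DoubleCentralizer.norm_fst, DoubleCentralizer.coe_fst, ContinuousLinearMap.opNorm_mul_apply]

theorem LeftStrictTendsto.norm_le {u : ℕ → LeftMul A} {v : LeftMul A} {C : ℝ}
    (h : LeftStrictTendsto u v) (hC : ∀ n, ‖u n‖ ≤ C) : ‖v‖ ≤ C :=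
  v.1.opNorm_le_bound ((norm_nonneg _).trans (hC 0)) fun a =>
    le_of_tendsto (h a).norm (Eventually.of_forall fun n => (u n).1.le_of_opNorm_le (hC n) a)

end DoubleCentralizers

section Representation

variable {A : Type*} [NonUnitalCStarAlgebra A]
  {H : Type*} [NormedAddCommGroup H] [InnerProductSpace ℂ H] [CompleteSpace H]
  {π : A →⋆ₙₐ[ℂ] (H →L[ℂ] H)}

theorem Nondegenerate.eq_of_mul_eq (hπ : Nondegenerate π) {S T : H →L[ℂ] H}
    (h : ∀ a, S * π a = T * π a) : S = T := by
  refine ContinuousLinearMap.ext_on hπ ?_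
  rintro _ ⟨a, ξ, rfl⟩
  exact DFunLike.congr_fun (h a) ξ

theorem Nondegenerate.eq_of_mul_mul_eq (hπ : Nondegenerate π) {S T : H →L[ℂ] H}
    (h : ∀ a b, π a * S * π b = π a * T * π b) : S = T := by
  refine hπ.eq_of_mul_eq fun b => star_injective (hπ.eq_of_mul_eq fun a => star_injective ?_)
  simpa only [star_mul, star_star, map_star, mul_assoc] using h (star a) b

theorem extendRep_mul_apply (hπ : Nondegenerate π) (m : 𝓜(ℂ, A)) (a : A) :
    extendRep π m * π a = π (m.fst a) :=
  ContinuousLinearMap.ext (extendRep_apply hπ m a)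

theorem extendRep_star (hπ : Nondegenerate π) (m : 𝓜(ℂ, A)) :
    extendRep π (star m) = star (extendRep π m) := by
  refine hπ.eq_of_mul_mul_eq fun a b => ?_
  have hleft : star (extendRep π m * π (star a)) = π a * star (extendRep π m) := by
    rw [star_mul, ← map_star, star_star]
  rw [mul_assoc, extendRep_mul_apply hπ, ← map_mul, ← hleft, extendRep_mul_apply hπ, ← map_star,
    ← map_mul]
  congr 1
  simpa using (star_fst_mul (star m) (star a) b).symm

/-- The canonical extension of a non-degenerate representation of `A` to `M(A)`, as a unital
`*`-homomorphism. -/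
noncomputable def extendRepHom (hπ : Nondegenerate π) : 𝓜(ℂ, A) →⋆ₐ[ℂ] (H →L[ℂ] H) where
  toFun := extendRep π
  map_one' := hπ.eq_of_mul_eq fun a => by
    rw [extendRep_mul_apply hπ, one_mul, DoubleCentralizer.one_fst]
    rfl
  map_mul' m n := hπ.eq_of_mul_eq fun a => by
    rw [mul_assoc]
    simp only [extendRep_mul_apply hπ, DoubleCentralizer.mul_fst, mul_apply_eq_comp]
  map_zero' := hπ.eq_of_mul_eq fun a => by
    rw [extendRep_mul_apply hπ, zero_mul, DoubleCentralizer.zero_fst, zero_apply, map_zero]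
  map_add' m n := hπ.eq_of_mul_eq fun a => by
    simp only [add_mul, extendRep_mul_apply hπ, DoubleCentralizer.add_fst, add_apply, map_add]
  commutes' c := hπ.eq_of_mul_eq fun a => by
    rw [extendRep_mul_apply hπ, Algebra.algebraMap_eq_smul_one, Algebra.algebraMap_eq_smul_one]
    simp
  map_star' := extendRep_star hπ

theorem extendRepHom_injective (hinj : Function.Injective π) (hπ : Nondegenerate π) :
    Function.Injective (extendRepHom hπ) := fun m n h => ext_fst fun a => hinj <| by
  rw [← extendRep_mul_apply hπ, ← extendRep_mul_apply hπ]
  exact congrArg (· * π a) h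

theorem norm_extendRepHom (hinj : Function.Injective π) (hπ : Nondegenerate π) (m : 𝓜(ℂ, A)) :
    ‖extendRepHom hπ m‖ = ‖m‖ :=
  NonUnitalStarAlgHom.norm_map (extendRepHom hπ) (extendRepHom_injective hinj hπ) m

theorem monotone_sum_range_star_mul_self {R : Type*} [NonUnitalRing R] [StarRing R] [PartialOrder R]
    [StarOrderedRing R] (x : ℕ → R) : Monotone fun n => ∑ i ∈ Finset.range n, star (x i) * x i :=
  monotone_nat_of_le_succ fun n => by
    rw [Finset.sum_range_succ]
    exact le_add_of_nonneg_right (star_mul_self_nonneg (x n))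

theorem boundedPartialSums_iff_stronglyConvergent (hinj : Function.Injective π)
    (hπ : Nondegenerate π) (α : ℕ → 𝓜(ℂ, A)) :
    BoundedPartialSums α ↔ StronglyConvergent π α := by
  let T : ℕ → H →L[ℂ] H := fun n => extendRepHom hπ (∑ i ∈ Finset.range n, star (α i) * α i)
  have hT_sum (n : ℕ) : T n = ∑ i ∈ Finset.range n, extendRep π (star (α i) * α i) :=
    map_sum (extendRepHom hπ) _ _
  have hT_mono : Monotone T := by
    simpa only [T, map_sum, map_mul, map_star] using
      monotone_sum_range_star_mul_self fun i => extendRepHom hπ (α i)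
  have hbounded : BoundedPartialSums α ↔ ∃ C, ∀ n, ‖T n‖ ≤ C := by
    simp only [BoundedPartialSums, T, norm_extendRepHom hinj hπ]
  have hstrong : StronglyConvergent π α ↔
      ∃ S : H →L[ℂ] H, ∀ ξ, Tendsto (fun n => T n ξ) atTop (𝓝 (S ξ)) := by
    simp only [StronglyConvergent, hT_sum, sum_apply]
  rw [hbounded, hstrong]
  exact ⟨fun ⟨_, hC⟩ => exists_tendsto_apply_of_monotone_of_norm_le hT_mono hC,
    fun ⟨_, hS⟩ => exists_norm_le_of_tendsto_apply hS⟩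

end Representation

section MultiplierModule

variable {A : Type*} [NonUnitalCStarAlgebra A]

theorem le_of_sq_le_mul {x y : ℝ} (hy : 0 ≤ y) (h : x ^ 2 ≤ y * x) : x ≤ y :=
  le_of_not_gt fun hyx => by nlinarith

theorem mulNorm_sq (β : MulEllTwo A) : ‖β‖ ^ 2 = ‖mulInner β β‖ :=
  Real.sq_sqrt (norm_nonneg _)

theorem mulNorm_nonneg (β : MulEllTwo A) : 0 ≤ ‖β‖ := Real.sqrt_nonneg _

theorem ellInner_apply_apply (β γ : MulEllTwo A) (a b : A) :
    ellInner (β.1 a) (γ.1 b) = star a * (mulInner β γ).fst b :=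
  ellInner_apply β a (γ.1 b)

theorem mulInner_eq {β γ : MulEllTwo A} {m : 𝓜(ℂ, A)}
    (h : ∀ a b, ellInner (β.1 a) (γ.1 b) = star a * m.fst b) : mulInner β γ = m :=
  ext_fst fun b => adj_eq fun a => h a b

theorem star_mulInner (β γ : MulEllTwo A) : star (mulInner β γ) = mulInner γ β :=
  Eq.symm <| mulInner_eq fun a b => by
    rw [← star_ellInner, ellInner_apply_apply, star_mul, star_star, ← star_fst_mul, star_star]

theorem norm_apply_le (β : MulEllTwo A) (a : A) : ‖β.1 a‖ ≤ ‖β‖ * ‖a‖ := by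
  refine le_of_sq_le_sq ?_ (mul_nonneg (mulNorm_nonneg β) (norm_nonneg a))
  calc ‖β.1 a‖ ^ 2 = ‖star a * (mulInner β β).fst a‖ := by rw [ellNorm_sq, ellInner_apply_apply]
    _ ≤ ‖a‖ * (‖mulInner β β‖ * ‖a‖) := by
        refine norm_mul_le_of_le (norm_star a).le ?_
        exact (mulInner β β).fst.le_of_opNorm_le (DoubleCentralizer.norm_fst _).le a
    _ = (‖β‖ * ‖a‖) ^ 2 := by rw [mul_pow, mulNorm_sq]; ring

theorem norm_mulInner_le (β γ : MulEllTwo A) : ‖mulInner β γ‖ ≤ ‖β‖ * ‖γ‖ := by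
  have hβγ : 0 ≤ ‖β‖ * ‖γ‖ := mul_nonneg (mulNorm_nonneg β) (mulNorm_nonneg γ)
  rw [← DoubleCentralizer.norm_fst]
  refine ContinuousLinearMap.opNorm_le_bound _ hβγ fun a => ?_
  set t := (mulInner β γ).fst a with ht
  refine le_of_sq_le_mul (mul_nonneg hβγ (norm_nonneg a)) ?_
  calc ‖t‖ ^ 2 = ‖ellInner (β.1 t) (γ.1 a)‖ := by
        rw [ellInner_apply_apply, ← ht, CStarRing.norm_star_mul_self, sq]
    _ ≤ ‖β.1 t‖ * ‖γ.1 a‖ := norm_ellInner_le _ _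
    _ ≤ (‖β‖ * ‖t‖) * (‖γ‖ * ‖a‖) :=
        mul_le_mul (norm_apply_le β t) (norm_apply_le γ a) (ellNorm_nonneg _)
          (mul_nonneg (mulNorm_nonneg β) (norm_nonneg t))
    _ = ‖β‖ * ‖γ‖ * ‖a‖ * ‖t‖ := by ring

/-- The functional `γ ↦ ⟨β, γ⟩` on `M(ℓ₂(A))`, as an `M(A)`-linear map. -/
noncomputable def mulInnerₗ (β : MulEllTwo A) : MulEllTwo A →ₗ[𝓜(ℂ, A)ᵐᵒᵖ] 𝓜(ℂ, A) where
  toFun := mulInner β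
  map_add' γ δ := mulInner_eq fun a b => by
    change ellInner (β.1 a) (γ.1 b + δ.1 b) = _
    rw [ellInner_add_right, ellInner_apply_apply, ellInner_apply_apply, ← mul_add]
    rfl
  map_smul' m γ := mulInner_eq fun a b => ellInner_apply_apply β γ a (m.unop.fst b)

-- Instance search does not unify the additive monoid of `Submodule.addCommGroup` with this one.
noncomputable instance : AddCommGroup (MulEllTwo A) :=
  Module.addCommMonoidToAddCommGroup 𝓜(ℂ, A)ᵐᵒᵖ

theorem mulInner_sub_right (β γ δ : MulEllTwo A) :
    mulInner β (γ - δ) = mulInner β γ - mulInner β δ :=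
  map_sub (mulInnerₗ β) γ δ

theorem mulInner_sub_left (β γ δ : MulEllTwo A) :
    mulInner (β - γ) δ = mulInner β δ - mulInner γ δ := by
  simp only [← star_mulInner δ, mulInner_sub_right, star_sub]

theorem mulInner_op_smul_right (β γ : MulEllTwo A) (m : 𝓜(ℂ, A)) :
    mulInner β (MulOpposite.op m • γ) = mulInner β γ * m :=
  map_smul (mulInnerₗ β) (MulOpposite.op m) γ

theorem mulInner_op_smul_left (β γ : MulEllTwo A) (m : 𝓜(ℂ, A)) :
    mulInner (MulOpposite.op m • β) γ = star m * mulInner β γ := by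
  simp only [← star_mulInner γ, mulInner_op_smul_right, star_mul]

theorem norm_op_coe_smul (β : MulEllTwo A) (a : A) :
    ‖MulOpposite.op (a : 𝓜(ℂ, A)) • β‖ = ‖β.1 a‖ := by
  let coeHom : A →⋆ₙₐ[ℂ] 𝓜(ℂ, A) := DoubleCentralizer.coeHom
  have hinner : mulInner (MulOpposite.op (a : 𝓜(ℂ, A)) • β) (MulOpposite.op (a : 𝓜(ℂ, A)) • β) =
      (ellInner (β.1 a) (β.1 a) : A) := by
    rw [mulInner_op_smul_right, mulInner_op_smul_left, mul_assoc, mul_coe, ellInner_apply_apply]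
    exact ((map_mul coeHom _ _).trans (congrArg (· * _) (map_star coeHom a))).symm
  refine (pow_left_inj₀ (mulNorm_nonneg _) (ellNorm_nonneg _) two_ne_zero).1 ?_
  rw [mulNorm_sq, ellNorm_sq, hinner, norm_coe]

theorem coord_basisMul (i j : ℕ) : coord (basisMul i : MulEllTwo A) j = if j = i then 1 else 0 :=
  ext_fst fun a => by
    rw [coord_fst]
    refine (Pi.single_apply i a j).trans ?_
    split_ifs <;> rfl

/-- The finitely supported element of `M(ℓ₂(A))` with coordinates `mᵢ` for `i ∈ s`. -/
noncomputable def basisSum (s : Finset ℕ) (m : ℕ → 𝓜(ℂ, A)) : MulEllTwo A :=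
  ∑ i ∈ s, MulOpposite.op (m i) • basisMul i

theorem mulInner_basisSum_right (β : MulEllTwo A) (s : Finset ℕ) (m : ℕ → 𝓜(ℂ, A)) :
    mulInner β (basisSum s m) = ∑ i ∈ s, mulInner β (basisMul i) * m i := by
  simp only [← mulInner_op_smul_right]
  exact map_sum (mulInnerₗ β) _ s

theorem mulInner_basisSum_left (s : Finset ℕ) (m : ℕ → 𝓜(ℂ, A)) (β : MulEllTwo A) :
    mulInner (basisSum s m) β = ∑ i ∈ s, star (m i) * coord β i := by
  simp only [← star_mulInner β, mulInner_basisSum_right, star_sum, star_mul, coord]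

theorem coord_basisSum (s : Finset ℕ) (m : ℕ → 𝓜(ℂ, A)) (j : ℕ) :
    coord (basisSum s m) j = if j ∈ s then m j else 0 := by
  have hcoord (i : ℕ) : mulInner (basisMul j) (basisMul i) = if j = i then (1 : 𝓜(ℂ, A)) else 0 :=
    coord_basisMul i j
  simp only [coord, mulInner_basisSum_right, hcoord, ite_mul, one_mul, zero_mul,
    Finset.sum_ite_eq]

theorem norm_basisSum_sq (s : Finset ℕ) (m : ℕ → 𝓜(ℂ, A)) :
    ‖basisSum s m‖ ^ 2 = ‖∑ i ∈ s, star (m i) * m i‖ := by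
  rw [mulNorm_sq, mulInner_basisSum_left]
  congr 1
  exact Finset.sum_congr rfl fun i hi => by rw [coord_basisSum, if_pos hi]

theorem mulInner_sub_basisSum_coord_self (β : MulEllTwo A) (s : Finset ℕ) :
    mulInner (β - basisSum s (coord β)) (β - basisSum s (coord β)) =
      mulInner β β - ∑ i ∈ s, star (coord β i) * coord β i := by
  have horth : mulInner (basisSum s (coord β)) (β - basisSum s (coord β)) = 0 := by
    rw [mulInner_basisSum_left]
    refine Finset.sum_eq_zero fun i hi => ?_
    have hcoord : coord (β - basisSum s (coord β)) i = coord β i - coord (basisSum s (coord β)) i :=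
      mulInner_sub_right _ _ _
    rw [hcoord, coord_basisSum, if_pos hi, sub_self, mul_zero]
  have hproj : mulInner β (basisSum s (coord β)) = ∑ i ∈ s, star (coord β i) * coord β i := by
    simp only [mulInner_basisSum_right, coord, star_mulInner]
  rw [mulInner_sub_left, horth, sub_zero, mulInner_sub_right, hproj]

theorem tendsto_norm_sub_basisSum_coord_apply (β : MulEllTwo A) (a : A) :
    Tendsto (fun s => ‖(β - basisSum s (coord β)).1 a‖) atTop (𝓝 0) := by
  have hinner (s : Finset ℕ) : ellInner ((β - basisSum s (coord β)).1 a)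
      ((β - basisSum s (coord β)).1 a) =
        ellInner (β.1 a) (β.1 a) - ∑ i ∈ s, star ((β.1 a).1 i) * (β.1 a).1 i := by
    rw [ellInner_apply_apply, mulInner_sub_basisSum_coord_self, DoubleCentralizer.sub_fst,
      sub_apply, mul_sub, ← ellInner_apply_apply, sum_fst_apply, Finset.mul_sum]
    simp only [DoubleCentralizer.mul_fst, mul_apply_eq_comp, ← star_fst_mul, star_star, coord_fst]
  change Tendsto (fun s => √‖ellInner ((β - basisSum s (coord β)).1 a)
    ((β - basisSum s (coord β)).1 a)‖) atTop (𝓝 0)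
  simp only [hinner]
  have hsum : Tendsto (fun s => ∑ i ∈ s, star ((β.1 a).1 i) * (β.1 a).1 i) atTop
      (𝓝 (ellInner (β.1 a) (β.1 a))) := hasSum_ellInner (β.1 a) (β.1 a)
  simpa using (hsum.const_sub (ellInner (β.1 a) (β.1 a))).norm.sqrt

end MultiplierModule

section DualModule

variable {A : Type*} [NonUnitalCStarAlgebra A]

/-- The sequence `αᵢ = F(eᵢ)*` in `M(A)` that represents the functional `F`. -/
noncomputable def dualCoord (F : Dual A) (i : ℕ) : 𝓜(ℂ, A) := star (F.1 (basisMul i))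

theorem dual_basisSum (F : Dual A) (s : Finset ℕ) (m : ℕ → 𝓜(ℂ, A)) :
    F.1 (basisSum s m) = ∑ i ∈ s, star (dualCoord F i) * m i := by
  simp only [basisSum, map_sum, map_smul, dualCoord, star_star, MulOpposite.smul_eq_mul_unop,
    MulOpposite.unop_op]

theorem boundedPartialSums_dualCoord (F : Dual A) : BoundedPartialSums (dualCoord F) := by
  obtain ⟨C, hC⟩ := F.2
  refine ⟨C ^ 2, fun n => le_of_sq_le_mul (sq_nonneg C) ?_⟩
  rw [← norm_basisSum_sq, ← mul_pow, norm_basisSum_sq, ← dual_basisSum]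
  exact pow_le_pow_left₀ (norm_nonneg _) (hC _) 2

theorem norm_fst_le_of_bound {F : MulEllTwo A →ₗ[𝓜(ℂ, A)ᵐᵒᵖ] 𝓜(ℂ, A)} {C : ℝ}
    (hC : ∀ β, ‖F β‖ ≤ C * ‖β‖) (β : MulEllTwo A) (a : A) : ‖(F β).fst a‖ ≤ C * ‖β.1 a‖ := by
  simpa only [map_smul, MulOpposite.smul_eq_mul_unop, MulOpposite.unop_op, mul_coe, norm_coe,
    norm_op_coe_smul] using hC (MulOpposite.op (a : 𝓜(ℂ, A)) • β)

theorem hasSum_dual (F : Dual A) (β : MulEllTwo A) (a : A) :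
    HasSum (fun i => (star (dualCoord F i) * coord β i).fst a) ((F.1 β).fst a) := by
  obtain ⟨C, hC⟩ := F.2
  have hremainder (s : Finset ℕ) :
      ‖∑ i ∈ s, (star (dualCoord F i) * coord β i).fst a - (F.1 β).fst a‖ ≤
        C * ‖(β - basisSum s (coord β)).1 a‖ := by
    rw [norm_sub_rev, ← sum_fst_apply, ← dual_basisSum, ← sub_apply, ← DoubleCentralizer.sub_fst,
      ← map_sub]
    exact norm_fst_le_of_bound hC _ a
  have hzero := (tendsto_norm_sub_basisSum_coord_apply β a).const_mul C
  rw [mul_zero] at hzero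
  exact tendsto_iff_norm_sub_tendsto_zero.2
    (squeeze_zero (fun _ => norm_nonneg _) hremainder hzero)

theorem dual_leftStrictTendsto (F : Dual A) (β : MulEllTwo A) :
    LeftStrictTendsto (partialSum (dualCoord F) β) (toLeftMul (F.1 β)) := fun a => by
  simpa only [partialSum, toLeftMul_apply, sum_fst_apply] using (hasSum_dual F β a).tendsto_sum_nat

theorem isDualSeq_dualCoord (F : Dual A) : IsDualSeq (dualCoord F) :=
  isDualSeq_of_limits (boundedPartialSums_dualCoord F) fun β => ⟨F.1 β, dual_leftStrictTendsto F β⟩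

theorem exists_dual_of_leftStrictTendsto {L : ℕ → MulEllTwo A →ₗ[𝓜(ℂ, A)ᵐᵒᵖ] 𝓜(ℂ, A)} {C : ℝ}
    (hC : ∀ n β, ‖L n β‖ ≤ C * ‖β‖)
    (hL : ∀ β, ∃ m, LeftStrictTendsto (fun n => toLeftMul (L n β)) (toLeftMul m)) :
    ∃ F : Dual A, ∀ β, LeftStrictTendsto (fun n => toLeftMul (L n β)) (toLeftMul (F.1 β)) := by
  choose f hf using hL
  have f_eq {β : MulEllTwo A} {m : 𝓜(ℂ, A)}
      (hm : LeftStrictTendsto (fun n => toLeftMul (L n β)) (toLeftMul m)) : f β = m :=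
    toLeftMul_injective ((hf β).unique hm)
  have f_add (β γ : MulEllTwo A) : f (β + γ) = f β + f γ := f_eq fun a => by
    simp only [map_add]
    exact (hf β a).add (hf γ a)
  have f_smul (m : 𝓜(ℂ, A)ᵐᵒᵖ) (β : MulEllTwo A) : f (m • β) = m • f β := f_eq fun a => by
    simp only [map_smul]
    exact hf β (m.unop.fst a)
  have f_bound (β : MulEllTwo A) : ‖f β‖ ≤ C * ‖β‖ := by
    rw [← norm_toLeftMul]
    exact (hf β).norm_le fun n => (norm_toLeftMul _).trans_le (hC n β)
  exact ⟨⟨⟨⟨f, f_add⟩, f_smul⟩, C, f_bound⟩, hf⟩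

theorem partialSum_eq_toLeftMul_mulInnerₗ (α : ℕ → 𝓜(ℂ, A)) (β : MulEllTwo A) (n : ℕ) :
    partialSum α β n = toLeftMul (mulInnerₗ (basisSum (Finset.range n) α) β) :=
  congrArg toLeftMul (mulInner_basisSum_left (Finset.range n) α β).symm

theorem IsDualSeq.exists_dual {α : ℕ → 𝓜(ℂ, A)} (h : IsDualSeq α) :
    ∃ F : Dual A, ∀ β, LeftStrictTendsto (partialSum α β) (toLeftMul (F.1 β)) := by
  obtain ⟨C, hC⟩ := h.bounded
  have norm_basisSum_le (n : ℕ) : ‖basisSum (Finset.range n) α‖ ≤ √C :=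
    Real.le_sqrt_of_sq_le ((norm_basisSum_sq _ α).trans_le (hC n))
  have norm_le (n : ℕ) (β : MulEllTwo A) :
      ‖mulInnerₗ (basisSum (Finset.range n) α) β‖ ≤ √C * ‖β‖ :=
    (norm_mulInner_le _ β).trans
      (mul_le_mul_of_nonneg_right (norm_basisSum_le n) (mulNorm_nonneg β))
  obtain ⟨F, hF⟩ := exists_dual_of_leftStrictTendsto norm_le fun β => by
    simpa only [← partialSum_eq_toLeftMul_mulInnerₗ] using h.exists_limit β
  exact ⟨F, fun β => by simpa only [← partialSum_eq_toLeftMul_mulInnerₗ] using hF β⟩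

theorem leftStrictTendsto_partialSum_basisMul (α : ℕ → 𝓜(ℂ, A)) (i : ℕ) :
    LeftStrictTendsto (partialSum α (basisMul i)) (toLeftMul (star (α i))) := fun a => by
  refine tendsto_const_nhds.congr' ?_
  filter_upwards [eventually_gt_atTop i] with n hn
  simp only [partialSum, coord_basisMul, mul_ite, mul_one, mul_zero, Finset.sum_ite_eq',
    Finset.mem_range.2 hn, if_true]

theorem dualCoord_eq {α : ℕ → 𝓜(ℂ, A)} {F : Dual A}
    (h : ∀ β, LeftStrictTendsto (partialSum α β) (toLeftMul (F.1 β))) : dualCoord F = α := by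
  funext i
  have hF : F.1 (basisMul i) = star (α i) :=
    toLeftMul_injective ((h _).unique (leftStrictTendsto_partialSum_basisMul α i))
  rw [dualCoord, hF, star_star]

theorem dualCoord_injective : Function.Injective (dualCoord : Dual A → ℕ → 𝓜(ℂ, A)) :=
  fun F G h => Subtype.ext <| LinearMap.ext fun β =>
    toLeftMul_injective <| (dual_leftStrictTendsto F β).unique <| by
      rw [h]
      exact dual_leftStrictTendsto G β

/-- The map `F ↦ (F(eᵢ)*)ᵢ` from the dual module to the module of sequences. It is linear, not
conjugate linear, because `M(A)` acts on the dual by `(F m)(β) = m* F(β)`. -/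
noncomputable def dualToSeq : Dual A →ₗ[𝓜(ℂ, A)ᵐᵒᵖ] DualSeq A where
  toFun F := ⟨dualCoord F, isDualSeq_dualCoord F⟩
  map_add' F G := Subtype.ext <| funext fun i => star_add (F.1 (basisMul i)) (G.1 (basisMul i))
  map_smul' m F := Subtype.ext <| funext fun i =>
    (star_mul (star m.unop) (F.1 (basisMul i))).trans (by rw [star_star]; rfl)

theorem dualToSeq_bijective : Function.Bijective (dualToSeq : Dual A → DualSeq A) := by
  refine ⟨fun F G h => dualCoord_injective (congrArg Subtype.val h), fun α => ?_⟩
  obtain ⟨F, hF⟩ := α.2.exists_dual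
  exact ⟨F, Subtype.ext (dualCoord_eq hF)⟩

end DualModule

end MultiplierDual

theorem mainTheorem2 {A : Type*} [NonUnitalCStarAlgebra A]
    {H : Type*} [NormedAddCommGroup H] [InnerProductSpace ℂ H] [CompleteSpace H]
    (π : A →⋆ₙₐ[ℂ] (H →L[ℂ] H))
    (hπ_inj : Function.Injective π) (hπ : MultiplierDual.Nondegenerate π) :
    (∀ α : ℕ → 𝓜(ℂ, A), MultiplierDual.BoundedPartialSums α ↔ MultiplierDual.StronglyConvergent π α) ∧
    ∃ Φ : MultiplierDual.Dual A ≃ₗ[𝓜(ℂ, A)ᵐᵒᵖ] MultiplierDual.DualSeq A,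
      ∀ (F : MultiplierDual.Dual A) (β : MultiplierDual.MulEllTwo A),
        MultiplierDual.LeftStrictTendsto (MultiplierDual.partialSum (Φ F).1 β)
          (MultiplierDual.toLeftMul (F.1 β)) :=
  ⟨MultiplierDual.boundedPartialSums_iff_stronglyConvergent hπ_inj hπ,
    LinearEquiv.ofBijective MultiplierDual.dualToSeq MultiplierDual.dualToSeq_bijective,
    MultiplierDual.dual_leftStrictTendsto⟩
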